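/- **Theorem 4.3.** Let $\mathbb{F}_q$ be a finite field with $q$ odd, let $n\ge 1$, let $a_1,\dots,a_n\in\mathbb{F}_q^*$ and $b\in\mathbb{F}_q$, and let $$f(x_1,\dots,x_n)=\sum_{j=1}^n a_j\,x_1^{d_{1,j}}x_2^{d_{2,j}}\cdots x_j^{d_{j,j}}-b,\qquad d_{i,j}\in\mathbb{Z}_{>0}\ \text{ for all } 1\le i\le j\le n,$$ be a fully triangular polynomial. Let $g(x_1,\dots,x_n)=a_1x_1^2+\cdots+a_nx_n^2-b$. Call two polynomials in $\mathbb{F}_q[x_1,\dots,x_k]$ *$*$-equivalent* if they can be written as $\sum_{j=1}^m c_jX^{D_j}$ and $\sum_{j=1}^m c_jX^{D'_j}$ with the same coefficient vector $(c_1,\dots,c_m)$, all $c_j\neq 0$, with $D_1,\dots,D_m\in\mathbb{Z}_{\ge0}^k$ pairwise distinct and $D'_1,\dots,D'_m\in\mathbb{Z}_{\ge0}^k$ pairwise distinct, in such a way that the systems $\tilde D v^T\equiv 0$ and $\tilde D' v^T\equiv 0 \pmod{q-1}$ have the same solutions $v$; here $\tilde D$ and $\tilde D'$ are the $(k+1)\times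 m$ matrices with $j$-th columns $(1,D_j)^T$ and $(1,D'_j)^T$. For $1\le k\le n$ put $f_k(x_1,\dots,x_k)=f(x_1,\dots,x_k,0,\dots,0)$, and define $g_k$ likewise. Suppose that $f$ is totally $*$-equivalent to $g$, that is, $f_k$ is $*$-equivalent to $g_k$ for all $1\le k\le n$. Let $\eta$ be the quadratic character of $\mathbb{F}_q$, and for $1\le k\le n$ let $$r(k)=\#\{1\le j\le k:\eta(a_j)=1\},\qquad s(k)=\#\{1\le j\le k:\eta(a_j)=-1\},\qquad r=r(n),\ s=s(n).$$ Let $w\in\mathbb{C}$ be a square root of $q(-1)^{(q-1)/2}$ (either one), and let $\zeta_1=w-1$, $\zeta_2=-w-1$. Let $N(f)$ be the number of roots of $f$ in $\mathbb{F}_q^n$. a) If $b\neq 0$, then $$\begin{aligned}N(f)={}&q^{n-2}(q-1)-\frac1{2q}\left(\zeta_1^{r}\zeta_2^{s}+\zeta_2^{r}\zeta_1^{s}\right)+\frac{\eta(b)}{2w}\left(\zeta_1^{r}\zeta_2^{s}-\zeta_2^{r}\zeta_1^{s}\right)\\&+\sum_{k=1}^{n-1}q^{n-k-1}\left(-\frac1{2q}\left(\zeta_1^{r(k)}\zeta_2^{s(k)}+\zeta_2^{r(k)}\zeta_1^{s(k)}\right)+\frac{\eta(b)}{2w}\left(\zeta_1^{r(k)}\zeta_2^{s(k)}-\zeta_2^{r(k)}\zeta_1^{s(k)}\right)\right).\end{aligned}$$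 b) If $b=0$, then $$N(f)=q^{n-1}+q^{n-2}(q-1)+\frac{q-1}{2q}\left(\zeta_1^{r}\zeta_2^{s}+\zeta_2^{r}\zeta_1^{s}\right)+\frac{q-1}{2}\sum_{k=1}^{n-1}q^{n-k-2}\left(\zeta_1^{r(k)}\zeta_2^{s(k)}+\zeta_2^{r(k)}\zeta_1^{s(k)}\right).$$ -/

import Mathlib

open MvPolynomial

noncomputable section

/-- The number `N(f)` of roots of `f` in `F ^ n`. -/
def rootCount {F : Type*} [Field F] {n : ℕ} (f : MvPolynomial (Fin n) F) : ℕ :=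
  Nat.card {x : Fin n → F // eval x f = 0}

/-- The augmented degree matrix of a list of monomials `X ^ D 0, …, X ^ D (m - 1)` in `n`
variables: its `j`-th column is `(1, D j)`. -/
def augDegreeMatrix {n m : ℕ} (D : Fin m → (Fin n →₀ ℕ)) : Matrix (Fin (n + 1)) (Fin m) ℕ :=
  Matrix.of fun i j => (Fin.cons 1 (fun i' => D j i') : Fin (n + 1) → ℕ) i

/-- `f = ∑ j, a j * X ^ D j` with pairwise different monomials and nonzero coefficients. -/
def IsExpansion {F : Type*} [Field F] {n m : ℕ} (f : MvPolynomial (Fin n) F)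
    (a : Fin m → F) (D : Fin m → (Fin n →₀ ℕ)) : Prop :=
  (∀ j, a j ≠ 0) ∧ Function.Injective D ∧ f = ∑ j, monomial (D j) (a j)

/-- Two polynomials over a finite field with `q` elements are `*`-equivalent if they can be written
with the same coefficient vector in such a way that the homogeneous systems modulo `q - 1` given
by their augmented degree matrices have the same solutions. -/
def StarEquiv {F : Type*} [Field F] [Fintype F] {n : ℕ} (f g : MvPolynomial (Fin n) F) : Prop :=
  ∃ (m : ℕ) (a : Fin m → F) (D D' : Fin m → (Fin n →₀ ℕ)),
    IsExpansion f a D ∧ IsExpansion g a D' ∧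
    ∀ v : Fin m → ZMod (Fintype.card F - 1),
      ((augDegreeMatrix D).map (fun d : ℕ => (d : ZMod (Fintype.card F - 1)))).mulVec v = 0 ↔
      ((augDegreeMatrix D').map (fun d : ℕ => (d : ZMod (Fintype.card F - 1)))).mulVec v = 0

/-- The polynomial `f_k(x_1, …, x_k) = f(x_1, …, x_k, 0, …, 0)` in `k` variables. -/
def truncate {F : Type*} [Field F] {n : ℕ} (k : ℕ) (f : MvPolynomial (Fin n) F) :
    MvPolynomial (Fin k) F :=
  aeval (fun i : Fin n => if h : (i : ℕ) < k then (X ⟨i, h⟩ : MvPolynomial (Fin k) F) else 0) f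

/-- Total `*`-equivalence: `f_k` is `*`-equivalent to `g_k` for all `1 ≤ k ≤ n`. -/
def TotallyStarEquiv {F : Type*} [Field F] [Fintype F] {n : ℕ}
    (f g : MvPolynomial (Fin n) F) : Prop :=
  ∀ k : ℕ, 1 ≤ k → k ≤ n → StarEquiv (truncate k f) (truncate k g)

/-- `f` is the fully triangular polynomial
`a_1 x_1^{d_{1,1}} + a_2 x_1^{d_{1,2}} x_2^{d_{2,2}} + ⋯ + a_n x_1^{d_{1,n}} ⋯ x_n^{d_{n,n}} - b`
for some exponents `d_{i,j} > 0` (`i ≤ j`), with nonzero `a_1, …, a_n`. -/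
def IsFullyTriangular {F : Type*} [Field F] {n : ℕ} (f : MvPolynomial (Fin n) F)
    (a : Fin n → F) (b : F) : Prop :=
  (∀ j, a j ≠ 0) ∧
  ∃ d : Fin n → Fin n → ℕ, (∀ i j, i ≤ j → 0 < d i j) ∧
    f = ∑ j, C (a j) * ∏ i ∈ Finset.Iic j, X i ^ d i j - C b

/-- The quadratic diagonal polynomial `a_1 x_1² + ⋯ + a_n x_n² - b`. -/
def quadDiagonal {F : Type*} [Field F] {n : ℕ} (a : Fin n → F) (b : F) :
    MvPolynomial (Fin n) F :=
  ∑ j, C (a j) * X j ^ 2 - C b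

/-- `r(k)`: how many of the first `k` coefficients `a_j` have `η(a_j) = 1`. -/
def numSq {F : Type*} [Field F] [Fintype F] [DecidableEq F] {n : ℕ} (a : Fin n → F) (k : ℕ) : ℕ :=
  (Finset.univ.filter fun j : Fin n => (j : ℕ) < k ∧ quadraticChar F (a j) = 1).card

/-- `s(k)`: how many of the first `k` coefficients `a_j` have `η(a_j) = -1`. -/
def numNonsq {F : Type*} [Field F] [Fintype F] [DecidableEq F] {n : ℕ} (a : Fin n → F)
    (k : ℕ) : ℕ :=
  (Finset.univ.filter fun j : Fin n => (j : ℕ) < k ∧ quadraticChar F (a j) = -1).card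

end

noncomputable section

/-! Write q for the size of F. Sort the roots of `f` by their first zero coordinate. If it is the
k-th (from 0), every monomial of index at least k vanishes, since all its exponents are positive.
The later coordinates are then free, and the earlier ones form a root of `truncate k f` in the torus
(F^*)^k (`IsFullyTriangular.rootCount_eq`). So only torus roots matter.

`StarEquiv.torusRootCount_eq` shows that `*`-equivalence preserves their number. Multiplying by a
nonzero scalar y turns `f` into the linear form ∑ a_j u_j at the image u of (y, x) under a
homomorphism of tori. The characters trivial on the range are the solutions of the augmented system
mod q - 1, so equal solution sets give equal ranges by duality. The fibres then have equal size too.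

This reduces the count to diagonal quadratic equations on the torus, which Gauss sums solve
(`card_diagonal_torus_eq`). In the total, the main terms (q - 1)^k / q sum to q^(n-1)
(`sum_pow_mul_add_eq`). -/

/-- The number of roots of `f` all of whose coordinates are nonzero. -/
def torusRootCount {F : Type*} [Field F] {n : ℕ} (f : MvPolynomial (Fin n) F) : ℕ :=
  Nat.card {x : Fin n → Fˣ // eval (fun i => (x i : F)) f = 0}

/-! ### Monomial maps of tori and `*`-equivalence -/

/-- The homomorphism of tori `(y, x) ↦ (y x ^ D 0, …, y x ^ D (m - 1))`. -/
def scaledMonomialHom (F : Type*) [Field F] {n m : ℕ} (D : Fin m → (Fin n →₀ ℕ)) :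
    Fˣ × (Fin n → Fˣ) →* (Fin m → Fˣ) where
  toFun p j := p.1 * ∏ i, p.2 i ^ D j i
  map_one' := by ext j; simp
  map_mul' p p' := by
    ext j
    simp only [Prod.fst_mul, Prod.snd_mul, Pi.mul_apply, mul_pow, Finset.prod_mul_distrib,
      Units.val_mul]
    ring

theorem scaledMonomialHom_apply {F : Type*} [Field F] {n m : ℕ} (D : Fin m → (Fin n →₀ ℕ))
    (p : Fˣ × (Fin n → Fˣ)) (j : Fin m) :
    scaledMonomialHom F D p j = p.1 * ∏ i, p.2 i ^ D j i := rfl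

theorem prod_scaledMonomialHom_zpow {F : Type*} [Field F] {n m : ℕ} (D : Fin m → (Fin n →₀ ℕ))
    (v : Fin m → ℤ) (p : Fˣ × (Fin n → Fˣ)) :
    ∏ j, scaledMonomialHom F D p j ^ v j =
      p.1 ^ (∑ j, v j) * ∏ i, p.2 i ^ (∑ j, (D j i : ℤ) * v j) := by
  have key (g : Fˣ) (u : Fin m → ℤ) : g ^ (∑ j, u j) = ∏ j, g ^ u j :=
    map_sum (zmultiplesHom (Additive Fˣ) (Additive.ofMul g)) u Finset.univ
  simp only [scaledMonomialHom_apply, mul_zpow, Finset.prod_mul_distrib, key]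
  rw [Finset.prod_comm]
  simp only [Finset.prod_zpow, zpow_mul, zpow_natCast]

theorem units_pow_card_sub_one {F : Type*} [Field F] [Fintype F] (g : Fˣ) :
    g ^ (Fintype.card F - 1) = 1 :=
  Units.ext (by simpa using FiniteField.pow_card_sub_one_eq_one (g : F) g.ne_zero)

theorem units_zpow_eq_one_of_cast_eq_zero {F : Type*} [Field F] [Fintype F] {z : ℤ}
    (hz : (z : ZMod (Fintype.card F - 1)) = 0) (g : Fˣ) : g ^ z = 1 := by
  obtain ⟨c, rfl⟩ := (ZMod.intCast_zmod_eq_zero_iff_dvd _ _).1 hz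
  rw [zpow_mul, zpow_natCast, units_pow_card_sub_one, one_zpow]

theorem cast_eq_zero_of_forall_units_zpow {F : Type*} [Field F] [Fintype F] {z : ℤ}
    (hz : ∀ g : Fˣ, g ^ z = 1) : (z : ZMod (Fintype.card F - 1)) = 0 := by
  obtain ⟨g, hg⟩ := IsCyclic.exists_generator (α := Fˣ)
  rw [ZMod.intCast_zmod_eq_zero_iff_dvd]
  have h := orderOf_dvd_iff_zpow_eq_one.2 (hz g)
  rwa [orderOf_eq_card_of_forall_mem_zpowers hg, Nat.card_units, Nat.card_eq_fintype_card] at h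

/-- Pulling the character `v` back along the monomial map gives a character whose exponents are the
entries of the augmented matrix times `v`. As F^* is cyclic of order q - 1, it is trivial exactly
when these vanish mod q - 1. The row of ones comes from the scalar factor. -/
theorem forall_prod_zpow_eq_one_iff {F : Type*} [Field F] [Fintype F] {n m : ℕ}
    (D : Fin m → (Fin n →₀ ℕ)) (v : Fin m → ℤ) :
    (∀ p, ∏ j, scaledMonomialHom F D p j ^ v j = 1) ↔
      ((augDegreeMatrix D).map (fun d : ℕ => (d : ZMod (Fintype.card F - 1)))).mulVec
        (fun j => (v j : ZMod (Fintype.card F - 1))) = 0 := by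
  have hrow0 : ((augDegreeMatrix D).map (fun d : ℕ => (d : ZMod (Fintype.card F - 1)))).mulVec
      (fun j => (v j : ZMod (Fintype.card F - 1))) 0 = ((∑ j, v j : ℤ) : ZMod _) := by
    simp [Matrix.mulVec, dotProduct, augDegreeMatrix]
  have hrow (i : Fin n) :
      ((augDegreeMatrix D).map (fun d : ℕ => (d : ZMod (Fintype.card F - 1)))).mulVec
      (fun j => (v j : ZMod (Fintype.card F - 1))) i.succ =
        ((∑ j, (D j i : ℤ) * v j : ℤ) : ZMod _) := by
    simp [Matrix.mulVec, dotProduct, augDegreeMatrix]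
  simp only [prod_scaledMonomialHom_zpow]
  constructor
  · intro h
    funext i
    refine Fin.cases ?_ (fun i => ?_) i
    · rw [hrow0]
      refine cast_eq_zero_of_forall_units_zpow fun g => ?_
      simpa using h (g, 1)
    · rw [hrow]
      refine cast_eq_zero_of_forall_units_zpow fun g => ?_
      have := h (1, Pi.mulSingle i g)
      rw [Finset.prod_eq_single i (fun i' _ hi' => by simp [Pi.mulSingle_eq_of_ne hi'])
        (by simp)] at this
      simpa using this
  · intro h p
    rw [units_zpow_eq_one_of_cast_eq_zero (by rw [← hrow0, h]; rfl), one_mul]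
    exact Finset.prod_eq_one fun i _ =>
      units_zpow_eq_one_of_cast_eq_zero (by rw [← hrow, h]; rfl) _

theorem hasEnoughRootsOfUnity_card_sub_one (F : Type*) [Field F] [Fintype F] :
    HasEnoughRootsOfUnity F (Fintype.card F - 1) := by
  obtain ⟨g, hg⟩ := IsCyclic.exists_generator (α := Fˣ)
  have hord : orderOf (g : F) = Fintype.card F - 1 := by
    rw [orderOf_units, orderOf_eq_card_of_forall_mem_zpowers hg, Nat.card_units,
      Nat.card_eq_fintype_card]
  have : NeZero (Fintype.card F - 1) := ⟨by have := Fintype.one_lt_card (α := F); omega⟩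
  exact ⟨⟨g, hord ▸ IsPrimitiveRoot.orderOf _⟩, inferInstance⟩

/-- Every character of a torus over a finite field is a monomial. -/
theorem exists_zpow_of_torus_character {F : Type*} [Field F] [Fintype F] {m : ℕ}
    -- On each factor the character is an endomorphism of a cyclic group, hence a power map.
    (χ : (Fin m → Fˣ) →* Fˣ) : ∃ v : Fin m → ℤ, ∀ h, χ h = ∏ j, h j ^ v j := by
  choose v hv using fun j => MonoidHom.map_cyclic (χ.comp (MonoidHom.mulSingle (fun _ => Fˣ) j))
  refine ⟨v, fun h => ?_⟩
  conv_lhs => rw [← Finset.univ_prod_mulSingle h]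
  rw [map_prod]
  exact Finset.prod_congr rfl fun j _ => hv j (h j)

/-- A subgroup of a torus over a finite field is cut out by the characters that kill it. -/
theorem exists_zpow_separating {F : Type*} [Field F] [Fintype F] {m : ℕ}
    (H : Subgroup (Fin m → Fˣ)) {u : Fin m → Fˣ} (hu : u ∉ H) :
    ∃ v : Fin m → ℤ, (∀ h ∈ H, ∏ j, h j ^ v j = 1) ∧ ∏ j, u j ^ v j ≠ 1 := by
  have : NeZero (Fintype.card F - 1) := ⟨by have := Fintype.one_lt_card (α := F); omega⟩
  -- The quotient is killed by q - 1, and F contains primitive (q - 1)-th roots of unity, so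
  -- F^*-valued characters separate its points.
  have hexp : Monoid.exponent ((Fin m → Fˣ) ⧸ H) ∣ Fintype.card F - 1 := by
    rw [Monoid.exponent_dvd_iff_forall_pow_eq_one]
    rintro ⟨g⟩
    change ((g ^ (Fintype.card F - 1) : Fin m → Fˣ) : (Fin m → Fˣ) ⧸ H) = 1
    have : g ^ (Fintype.card F - 1) = 1 := funext fun j => units_pow_card_sub_one (g j)
    rw [this]; rfl
  have := hasEnoughRootsOfUnity_card_sub_one F
  have := HasEnoughRootsOfUnity.of_dvd F hexp
  obtain ⟨χ, hχ⟩ := CommGroup.exists_apply_ne_one_of_hasEnoughRootsOfUnity _ F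
    (a := (u : (Fin m → Fˣ) ⧸ H)) (by rwa [Ne, QuotientGroup.eq_one_iff])
  obtain ⟨v, hv⟩ := exists_zpow_of_torus_character (χ.comp (QuotientGroup.mk' H))
  refine ⟨v, fun h hh => ?_, ?_⟩
  · rw [← hv, MonoidHom.comp_apply, QuotientGroup.mk'_apply, (QuotientGroup.eq_one_iff h).2 hh,
      map_one]
  · rw [← hv]
    exact hχ

theorem scaledMonomialHom_range_le {F : Type*} [Field F] [Fintype F] {n m : ℕ}
    {D D' : Fin m → (Fin n →₀ ℕ)}
    (h : ∀ v : Fin m → ZMod (Fintype.card F - 1),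
      ((augDegreeMatrix D).map (fun d : ℕ => (d : ZMod (Fintype.card F - 1)))).mulVec v = 0 →
      ((augDegreeMatrix D').map (fun d : ℕ => (d : ZMod (Fintype.card F - 1)))).mulVec v = 0) :
    (scaledMonomialHom F D').range ≤ (scaledMonomialHom F D).range := by
  rintro _ ⟨p, rfl⟩
  by_contra hu
  obtain ⟨v, hv, hne⟩ := exists_zpow_separating _ hu
  exact hne ((forall_prod_zpow_eq_one_iff D' v).2
    (h _ ((forall_prod_zpow_eq_one_iff D v).1 fun p => hv _ ⟨p, rfl⟩)) p)

/-- A nonempty fibre is a coset of the kernel, whose order is that of the group divided by that of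
the range. -/
theorem card_fiber_eq_of_range_eq {G M : Type*} [Group G] [Fintype G] [Group M] [DecidableEq M]
    {φ ψ : G →* M} (h : φ.range = ψ.range) (y : M) :
    (Finset.univ.filter fun g => φ g = y).card = (Finset.univ.filter fun g => ψ g = y).card := by
  have hker (φ : G →* M) : (Finset.univ.filter fun g => φ g = 1).card * Nat.card φ.range
      = Nat.card G := by
    rw [← φ.ker.card_mul_index, Subgroup.index_ker]
    congr 1
    exact (Nat.subtype_card _ (by simp [MonoidHom.mem_ker])).symm
  by_cases hy : y ∈ φ.range
  · have hy' : y ∈ ψ.range := h ▸ hy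
    rw [MonoidHom.card_fiber_eq_of_mem_range φ hy (one_mem φ.range),
      MonoidHom.card_fiber_eq_of_mem_range ψ hy' (one_mem ψ.range)]
    have := (hker φ).trans (hker ψ).symm
    rw [h] at this
    have : Finite ψ.range := Set.finite_range ψ
    exact Nat.eq_of_mul_eq_mul_right Nat.card_pos ‹_›
  · have hy' : y ∉ ψ.range := h ▸ hy
    rw [Finset.filter_false_of_mem, Finset.filter_false_of_mem]
    · exact fun g _ hg => hy' ⟨g, hg⟩
    · exact fun g _ hg => hy ⟨g, hg⟩

theorem card_preimage_eq_of_range_eq {G M : Type*} [Group G] [Fintype G] [Group M] [Fintype M]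
    [DecidableEq M] {φ ψ : G →* M} (h : φ.range = ψ.range) (P : M → Prop) [DecidablePred P] :
    (Finset.univ.filter fun g => P (φ g)).card = (Finset.univ.filter fun g => P (ψ g)).card := by
  have key (φ : G →* M) : (Finset.univ.filter fun g => P (φ g)).card =
      ∑ y ∈ Finset.univ.filter P, (Finset.univ.filter fun g => φ g = y).card := by
    rw [Finset.card_eq_sum_card_fiberwise (f := φ) (t := Finset.univ.filter P)
      (fun g hg => by simpa using hg)]
    refine Finset.sum_congr rfl fun y hy => ?_
    congr 1
    ext g
    simp only [Finset.mem_filter, Finset.mem_univ, true_and] at hy ⊢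
    exact ⟨fun h => h.2, fun h => ⟨h ▸ hy, h⟩⟩
  rw [key, key]
  exact Finset.sum_congr rfl fun y _ => card_fiber_eq_of_range_eq h y

/-- The free scalar does not affect vanishing; it only multiplies the count by the number of units.
-/
theorem card_units_mul_torusRootCount {F : Type*} [Field F] [Fintype F] [DecidableEq F]
    {n m : ℕ} {f : MvPolynomial (Fin n) F} {a : Fin m → F} {D : Fin m → (Fin n →₀ ℕ)}
    (hf : IsExpansion f a D) :
    Fintype.card Fˣ * torusRootCount f = (Finset.univ.filter fun p : Fˣ × (Fin n → Fˣ) =>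
      ∑ j, a j * (scaledMonomialHom F D p j : F) = 0).card := by
  have heval (x : Fin n → Fˣ) : eval (fun i => (x i : F)) f = ∑ j, a j * ∏ i, (x i : F) ^ D j i := by
    rw [hf.2.2, map_sum]
    refine Finset.sum_congr rfl fun j _ => ?_
    rw [eval_monomial, Finsupp.prod_fintype _ _ (by simp)]
  have hset : (Finset.univ.filter fun p : Fˣ × (Fin n → Fˣ) =>
      ∑ j, a j * (scaledMonomialHom F D p j : F) = 0) =
      Finset.univ ×ˢ Finset.univ.filter fun x : Fin n → Fˣ => eval (fun i => (x i : F)) f = 0 := by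
    ext p
    simp only [Finset.mem_filter, Finset.mem_univ, true_and, Finset.mem_product, heval]
    have : ∑ j, a j * (scaledMonomialHom F D p j : F) =
        p.1 * ∑ j, a j * ∏ i, (p.2 i : F) ^ D j i := by
      rw [Finset.mul_sum]
      refine Finset.sum_congr rfl fun j _ => ?_
      rw [scaledMonomialHom_apply]
      push_cast
      ring
    rw [this, mul_eq_zero, or_iff_right p.1.ne_zero]
  rw [hset, Finset.card_product, Finset.card_univ, torusRootCount, Nat.card_eq_fintype_card,
    Fintype.card_subtype]

/-- `*`-equivalent polynomials have equally many roots with all coordinates nonzero. -/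
theorem StarEquiv.torusRootCount_eq {F : Type*} [Field F] [Fintype F] [DecidableEq F] {n : ℕ}
    {f g : MvPolynomial (Fin n) F} (h : StarEquiv f g) :
    torusRootCount f = torusRootCount g := by
  obtain ⟨m, a, D, D', hf, hg, hv⟩ := h
  have hrange : (scaledMonomialHom F D).range = (scaledMonomialHom F D').range :=
    le_antisymm (scaledMonomialHom_range_le fun v => (hv v).2)
      (scaledMonomialHom_range_le fun v => (hv v).1)
  refine Nat.eq_of_mul_eq_mul_left (Fintype.card_pos (α := Fˣ)) ?_
  rw [card_units_mul_torusRootCount hf, card_units_mul_torusRootCount hg]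
  exact card_preimage_eq_of_range_eq hrange fun y => ∑ j, a j * (y j : F) = 0

/-! ### Gauss sums and diagonal quadratic equations on the torus -/

theorem sum_units_eq {F R : Type*} [Field F] [Fintype F] [DecidableEq F] [AddCommGroup R]
    (h : F → R) : ∑ u : Fˣ, h u = ∑ x, h x - h 0 := by
  rw [Fintype.sum_eq_add_sum_subtype_ne h 0, add_sub_cancel_left]
  exact Fintype.sum_equiv unitsEquivNeZero _ _ fun u => rfl

/-- The quadratic character of a finite field with values in `ℂ`. -/
def complexQuadraticChar (F : Type*) [Field F] [Fintype F] [DecidableEq F] : MulChar F ℂ :=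
  (quadraticChar F).ringHomComp (Int.castRingHom ℂ)

theorem complexQuadraticChar_apply {F : Type*} [Field F] [Fintype F] [DecidableEq F] (x : F) :
    complexQuadraticChar F x = ((quadraticChar F x : ℤ) : ℂ) := rfl

section GaussSums

variable {F : Type*} [Field F] [Fintype F] [DecidableEq F]

theorem complexQuadraticChar_ne_one (hF : ringChar F ≠ 2) : complexQuadraticChar F ≠ 1 := by
  rw [complexQuadraticChar, Ne, MulChar.ringHomComp_eq_one_iff Int.cast_injective]
  exact quadraticChar_ne_one hF

theorem complexQuadraticChar_mul_self {c : F} (hc : c ≠ 0) :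
    complexQuadraticChar F c * complexQuadraticChar F c = 1 := by
  rw [complexQuadraticChar_apply, ← Int.cast_mul, ← sq, quadraticChar_sq_one hc, Int.cast_one]

theorem sum_quadraticChar_mul_addChar (ψ : AddChar F ℂ) {c : F} (hc : c ≠ 0) :
    ∑ x, complexQuadraticChar F x * ψ (c * x) =
      complexQuadraticChar F c * gaussSum (complexQuadraticChar F) ψ := by
  have h := gaussSum_mulShift (complexQuadraticChar F) ψ (Units.mk0 c hc)
  rw [Units.val_mk0] at h
  rw [← h, ← mul_assoc, complexQuadraticChar_mul_self hc, one_mul]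
  rfl

theorem sum_addChar_mul_eq_zero {ψ : AddChar F ℂ} (hψ : ψ.IsPrimitive) {c : F} (hc : c ≠ 0) :
    ∑ x, ψ (c * x) = 0 := by
  simpa [mul_comm, hc] using AddChar.sum_mulShift c hψ

/-- Each y, including 0, has 1 + η(y) square roots. -/
theorem sum_comp_sq (hF : ringChar F ≠ 2) (h : F → ℂ) :
    ∑ x, h (x ^ 2) = ∑ y, (complexQuadraticChar F y + 1) * h y := by
  rw [← Finset.sum_fiberwise (s := Finset.univ) (g := fun x : F => x ^ 2)]
  refine Finset.sum_congr rfl fun y _ => ?_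
  rw [Finset.sum_congr rfl (g := fun _ => h y) (by simp +contextual), Finset.sum_const,
    nsmul_eq_mul]
  congr 1
  rw [complexQuadraticChar_apply]
  have := quadraticChar_card_sqrts hF y
  rw [← Int.cast_one, ← Int.cast_add, ← this, Int.cast_natCast]
  congr 2
  ext; simp

theorem sum_units_addChar_sq (hF : ringChar F ≠ 2) {ψ : AddChar F ℂ} (hψ : ψ.IsPrimitive)
    {c : F} (hc : c ≠ 0) :
    ∑ u : Fˣ, ψ (c * (u : F) ^ 2) =
      complexQuadraticChar F c * gaussSum (complexQuadraticChar F) ψ - 1 := by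
  rw [sum_units_eq (fun x => ψ (c * x ^ 2)), sum_comp_sq hF fun y => ψ (c * y)]
  simp only [add_mul, one_mul, Finset.sum_add_distrib]
  rw [sum_quadraticChar_mul_addChar ψ hc, sum_addChar_mul_eq_zero hψ hc]
  simp

/-- Counting the solutions in nonzero unknowns of a diagonal quadratic equation by characters. -/
theorem card_mul_card_diagonal_torus (hF : ringChar F ≠ 2) {ψ : AddChar F ℂ}
    (hψ : ψ.IsPrimitive) {k : ℕ} {a : Fin k → F} (ha : ∀ j, a j ≠ 0) (b : F) :
    (Fintype.card F : ℂ) * (Finset.univ.filter fun x : Fin k → Fˣ =>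
        ∑ j, a j * (x j : F) ^ 2 = b).card =
      ((Fintype.card F : ℂ) - 1) ^ k + ∑ t : Fˣ, ψ (-(t * b)) *
        ∏ j, (complexQuadraticChar F (t * a j) * gaussSum (complexQuadraticChar F) ψ - 1) := by
  have hcard : (Fintype.card Fˣ : ℂ) = (Fintype.card F : ℂ) - 1 := by
    rw [Fintype.card_units, Nat.cast_sub Fintype.card_pos, Nat.cast_one]
  have hterm (t : F) : ∑ x : Fin k → Fˣ, ψ (t * (∑ j, a j * (x j : F) ^ 2 - b)) =
      ψ (-(t * b)) * ∏ j, ∑ u : Fˣ, ψ (t * a j * (u : F) ^ 2) := by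
    rw [Fintype.prod_sum, Finset.mul_sum]
    refine Finset.sum_congr rfl fun x _ => ?_
    have hmap : ∏ j, ψ (t * a j * (x j : F) ^ 2) = ψ (∑ j, t * a j * (x j : F) ^ 2) :=
      (map_sum ψ.toAddMonoidHom (fun j => t * a j * (x j : F) ^ 2) Finset.univ).symm
    rw [hmap, ← AddChar.map_add_eq_mul]
    congr 1
    rw [mul_sub, Finset.mul_sum]
    simp only [mul_assoc]
    ring
  calc (Fintype.card F : ℂ) * (Finset.univ.filter fun x : Fin k → Fˣ =>
        ∑ j, a j * (x j : F) ^ 2 = b).card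
      = ∑ x : Fin k → Fˣ, ∑ t, ψ (t * (∑ j, a j * (x j : F) ^ 2 - b)) := by
        simp_rw [AddChar.sum_mulShift _ hψ, sub_eq_zero]
        rw [Finset.card_filter]
        push_cast
        rw [Finset.mul_sum]
        simp
    _ = ∑ t, ψ (-(t * b)) * ∏ j, ∑ u : Fˣ, ψ (t * a j * (u : F) ^ 2) := by
        rw [Finset.sum_comm]
        exact Finset.sum_congr rfl fun t _ => hterm t
    _ = ((Fintype.card F : ℂ) - 1) ^ k + ∑ t : Fˣ, ψ (-(t * b)) *
          ∏ j, ∑ u : Fˣ, ψ (t * a j * (u : F) ^ 2) := by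
        rw [sum_units_eq (fun t => ψ (-(t * b)) * ∏ j, ∑ u : Fˣ, ψ (t * a j * (u : F) ^ 2))]
        simp [hcard]
    _ = _ := by
        congr 1
        refine Finset.sum_congr rfl fun t _ => ?_
        congr 1
        exact Finset.prod_congr rfl fun j _ =>
          sum_units_addChar_sq hF hψ (mul_ne_zero t.ne_zero (ha j))

theorem prod_quadraticChar_mul_sub_one {k : ℕ} {a : Fin k → F} (ha : ∀ j, a j ≠ 0) (G : ℂ) :
    ∏ j, (complexQuadraticChar F (a j) * G - 1) =
      (G - 1) ^ numSq a k * (-G - 1) ^ numNonsq a k := by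
  rw [numSq, numNonsq, ← Finset.prod_const, ← Finset.prod_const, Finset.prod_filter,
    Finset.prod_filter, ← Finset.prod_mul_distrib]
  refine Finset.prod_congr rfl fun j _ => ?_
  rw [complexQuadraticChar_apply]
  rcases quadraticChar_dichotomy (ha j) with h | h <;> simp [h]

/-- The number of solutions in nonzero unknowns of a diagonal quadratic equation, in terms of
the quadratic Gauss sum `G`. -/
theorem card_diagonal_torus (hF : ringChar F ≠ 2) {ψ : AddChar F ℂ}
    (hψ : ψ.IsPrimitive) {k : ℕ} {a : Fin k → F} (ha : ∀ j, a j ≠ 0) (b : F)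
    {G A B : ℂ} (hG : G = gaussSum (complexQuadraticChar F) ψ)
    (hA : A = (G - 1) ^ numSq a k * (-G - 1) ^ numNonsq a k)
    (hB : B = (-G - 1) ^ numSq a k * (G - 1) ^ numNonsq a k) :
    (Fintype.card F : ℂ) * (Finset.univ.filter fun x : Fin k → Fˣ =>
        ∑ j, a j * (x j : F) ^ 2 = b).card =
      ((Fintype.card F : ℂ) - 1) ^ k +
        (if b = 0 then ((Fintype.card F : ℂ) - 1) / 2 * (A + B)
          else -(A + B) / 2 + complexQuadraticChar F (-b) * G / 2 * (A - B)) := by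
  rw [card_mul_card_diagonal_torus hF hψ ha b, ← hG]
  congr 1
  -- The product depends on t only through η(t): it is A for squares and B for nonsquares.
  -- Interpolating linearly in η(t) leaves one plain character sum and one Gauss sum over t.
  have hprod (t : Fˣ) : ∏ j, (complexQuadraticChar F (t * a j) * G - 1) =
      (A + B) / 2 + complexQuadraticChar F t * ((A - B) / 2) := by
    have h1 : ∏ j, (complexQuadraticChar F (t * a j) * G - 1) =
        ∏ j, (complexQuadraticChar F (a j) * (complexQuadraticChar F t * G) - 1) :=
      Finset.prod_congr rfl fun j _ => by rw [map_mul]; ring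
    rw [h1, prod_quadraticChar_mul_sub_one ha, complexQuadraticChar_apply]
    rcases quadraticChar_dichotomy t.ne_zero with h | h
    · rw [h, hA, hB]; push_cast; ring
    · rw [h, hA, hB]; push_cast; ring
  simp_rw [hprod, mul_add]
  rw [Finset.sum_add_distrib, ← Finset.sum_mul]
  have hassoc (t : Fˣ) : ψ (-(t * b)) * (complexQuadraticChar F t * ((A - B) / 2)) =
      (complexQuadraticChar F t * ψ (-(t * b))) * ((A - B) / 2) := by ring
  simp_rw [hassoc]
  rw [← Finset.sum_mul, sum_units_eq (fun t => ψ (-(t * b))),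
    sum_units_eq (fun t => complexQuadraticChar F t * ψ (-(t * b)))]
  have hneg (t : F) : -(t * b) = -b * t := by ring
  simp_rw [hneg]
  have hzero : complexQuadraticChar F 0 = 0 := MulChar.map_zero _
  split_ifs with hb
  · subst hb
    simp [hzero, MulChar.sum_eq_zero_of_ne_one (complexQuadraticChar_ne_one hF)]
    ring
  · rw [sum_addChar_mul_eq_zero hψ (neg_ne_zero.2 hb),
      sum_quadraticChar_mul_addChar ψ (neg_ne_zero.2 hb), ← hG]
    simp [hzero]
    ring

theorem ringChar_ne_two_of_odd_card {F : Type*} [Field F] [Fintype F] (hodd : Odd (Fintype.card F)) : ringChar F ≠ 2 := fun h =>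
  (Nat.not_even_iff_odd.2 hodd) ((FiniteField.even_card_iff_char_two.1 h) |> Nat.even_iff.2)

theorem complexQuadraticChar_neg_one (hodd : Odd (Fintype.card F)) :
    complexQuadraticChar F (-1) = (-1) ^ ((Fintype.card F - 1) / 2) := by
  rw [complexQuadraticChar_apply, quadraticChar_neg_one (ringChar_ne_two_of_odd_card hodd),
    ZMod.χ₄_eq_neg_one_pow (Nat.odd_iff.1 hodd)]
  obtain ⟨c, hc⟩ := hodd
  rw [hc, show (2 * c + 1) / 2 = c by omega, show (2 * c + 1 - 1) / 2 = c by omega]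
  push_cast
  rfl

/-- The number of solutions in nonzero unknowns of a diagonal quadratic equation, in terms of
either square root `w` of `q (-1) ^ ((q - 1) / 2)`. -/
theorem card_diagonal_torus_eq (hodd : Odd (Fintype.card F)) {k : ℕ} {a : Fin k → F}
    (ha : ∀ j, a j ≠ 0) (b : F) {w : ℂ}
    (hw : w ^ 2 = (Fintype.card F : ℂ) * (-1) ^ ((Fintype.card F - 1) / 2)) {A B : ℂ}
    (hA : A = (w - 1) ^ numSq a k * (-w - 1) ^ numNonsq a k)
    (hB : B = (-w - 1) ^ numSq a k * (w - 1) ^ numNonsq a k) :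
    ((Finset.univ.filter fun x : Fin k → Fˣ => ∑ j, a j * (x j : F) ^ 2 = b).card : ℂ) =
      ((Fintype.card F : ℂ) - 1) ^ k / Fintype.card F +
        (if b = 0 then ((Fintype.card F : ℂ) - 1) / (2 * Fintype.card F) * (A + B)
          else -(1 / (2 * (Fintype.card F : ℂ))) * (A + B)
            + ((quadraticChar F b : ℤ) : ℂ) / (2 * w) * (A - B)) := by
  have hF := ringChar_ne_two_of_odd_card hodd
  have hψ := AddChar.FiniteField.primitiveChar_to_Complex_isPrimitive F
  set ψ := AddChar.FiniteField.primitiveChar_to_Complex F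
  have hq0 : (Fintype.card F : ℂ) ≠ 0 := Nat.cast_ne_zero.2 Fintype.card_ne_zero
  have hG := gaussSum_sq (complexQuadraticChar_ne_one hF)
    ((quadraticChar_isQuadratic F).comp (Int.castRingHom ℂ)) hψ
  change _ = complexQuadraticChar F (-1) * _ at hG
  rw [mul_comm, complexQuadraticChar_neg_one hodd, ← hw] at hG
  have hw' : w ^ 2 = (Fintype.card F : ℂ) * complexQuadraticChar F (-1) := by
    rw [hw, complexQuadraticChar_neg_one hodd]
  have hw0 : w ≠ 0 := by
    rintro rfl
    have := complexQuadraticChar_mul_self (neg_ne_zero.2 (one_ne_zero (α := F)))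
    rw [zero_pow two_ne_zero, eq_comm, mul_eq_zero, or_iff_right hq0] at hw'
    rw [hw', zero_mul] at this
    exact zero_ne_one this
  -- This moves w to the denominator and absorbs η(-1), turning η(-b) w / (2q) into η(b) / (2w).
  have hwq : complexQuadraticChar F (-1) * w / Fintype.card F = 1 / w := by
    rw [div_eq_div_iff hq0 hw0]
    have := complexQuadraticChar_mul_self (neg_ne_zero.2 (one_ne_zero (α := F)))
    linear_combination complexQuadraticChar F (-1) * hw' + (Fintype.card F : ℂ) * this
  have hneg : complexQuadraticChar F (-b) =
      complexQuadraticChar F (-1) * ((quadraticChar F b : ℤ) : ℂ) := by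
    rw [← complexQuadraticChar_apply, ← map_mul, neg_one_mul]
  have key : (Fintype.card F : ℂ) * (Finset.univ.filter fun x : Fin k → Fˣ =>
        ∑ j, a j * (x j : F) ^ 2 = b).card =
      ((Fintype.card F : ℂ) - 1) ^ k +
        (if b = 0 then ((Fintype.card F : ℂ) - 1) / 2 * (A + B)
          else -(A + B) / 2 + complexQuadraticChar F (-b) * w / 2 * (A - B)) := by
    rcases sq_eq_sq_iff_eq_or_eq_neg.1 hG with h | h
    · exact card_diagonal_torus hF hψ ha b h.symm hA hB
    -- Replacing w by -w swaps A and B, so A + B and w (A - B) are unchanged and either root may be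
    -- used.
    · have := card_diagonal_torus hF hψ ha b h.symm rfl rfl
      rw [neg_neg, ← hA, ← hB] at this
      rw [this]
      congr 1
      split_ifs <;> ring
  have hdiv : ((Finset.univ.filter fun x : Fin k → Fˣ =>
      ∑ j, a j * (x j : F) ^ 2 = b).card : ℂ) = _ / (Fintype.card F : ℂ) :=
    eq_div_of_mul_eq hq0 ((mul_comm _ _).trans key)
  rw [hdiv, add_div]
  congr 1
  split_ifs with hb
  · field_simp
  · rw [hneg]
    linear_combination ((quadraticChar F b : ℤ) : ℂ) * (A - B) / 2 * hwq

end GaussSums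

/-! ### Sorting roots by the first zero coordinate -/

theorem eval_truncate {F : Type*} [Field F] {n : ℕ} (k : ℕ) (f : MvPolynomial (Fin n) F)
    (x : Fin k → F) :
    eval x (truncate k f) = eval (fun i : Fin n => if h : (i : ℕ) < k then x ⟨i, h⟩ else 0) f := by
  unfold truncate
  induction f using MvPolynomial.induction_on with
  | C c => simp
  | add p q hp hq => rw [map_add, map_add, hp, hq, map_add]
  | mul_X p i hp =>
    simp only [map_mul, aeval_X, hp, eval_X]
    split_ifs <;> simp

/-- Monomials of index at least k contain the k-th variable and vanish; the others involve only
earlier variables. -/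
theorem IsFullyTriangular.eval_eq_of_apply_eq_zero {F : Type*} [Field F] {n : ℕ}
    {f : MvPolynomial (Fin n) F} {a : Fin n → F} {b : F} (hf : IsFullyTriangular f a b)
    {x y : Fin n → F} {k : Fin n} (hx : x k = 0) (hy : y k = 0) (hxy : ∀ i < k, x i = y i) :
    eval x f = eval y f := by
  obtain ⟨-, d, hd, rfl⟩ := hf
  simp only [map_sub, map_sum, map_mul, eval_C, map_prod, map_pow, eval_X]
  congr 1
  refine Finset.sum_congr rfl fun j _ => ?_
  congr 1
  rcases lt_or_ge j k with hj | hj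
  · refine Finset.prod_congr rfl fun i hi => ?_
    rw [hxy i ((Finset.mem_Iic.1 hi).trans_lt hj)]
  · rw [Finset.prod_eq_zero (Finset.mem_Iic.2 hj), Finset.prod_eq_zero (Finset.mem_Iic.2 hj)]
    · rw [hy, zero_pow (hd _ _ hj).ne']
    · rw [hx, zero_pow (hd _ _ hj).ne']

/-- Points whose first vanishing coordinate is the `k`-th, with a condition on the coordinates
before it. -/
def firstZeroEquiv {F : Type*} [Field F] {n k : ℕ} (hk : k < n) (P : (Fin k → F) → Prop) :
    {x : Fin n → F // (∀ i : Fin n, (i : ℕ) < k → x i ≠ 0) ∧ x ⟨k, hk⟩ = 0 ∧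
        P (fun i => x (Fin.castLE hk.le i))} ≃
      (Fin (n - k - 1) → F) × {y : Fin k → Fˣ // P (fun i => (y i : F))} where
  toFun x := (fun i => x.1 ⟨k + 1 + i, by omega⟩,
    ⟨fun i => Units.mk0 (x.1 (Fin.castLE hk.le i)) (x.2.1 _ i.2), x.2.2.2⟩)
  invFun p := ⟨fun i => if h : (i : ℕ) < k then (p.2.1 ⟨i, h⟩ : F) else
      if h' : (i : ℕ) = k then 0 else p.1 ⟨i - (k + 1), by omega⟩, by
    refine ⟨fun i hi => ?_, ?_, ?_⟩
    · simp [hi]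
    · simp
    · simpa using p.2.2⟩
  left_inv x := by
    ext i
    rcases lt_trichotomy (i : ℕ) k with h | h | h
    · simp [h]
    · have hi : i = ⟨k, hk⟩ := Fin.ext h
      simp [hi, x.2.2.1]
    · simp only [h.not_gt, h.ne', dite_false]
      exact congrArg x.1 (Fin.ext (by simp only; omega))
  right_inv p := by
    refine Prod.ext ?_ (Subtype.ext ?_)
    · funext i
      have h1 : ¬ k + 1 + (i : ℕ) < k := by omega
      have h2 : ¬ k + 1 + (i : ℕ) = k := by omega
      simp only [h1, h2, dite_false]
      exact congrArg p.1 (Fin.ext (by simp))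
    · funext i
      ext
      simp

theorem IsFullyTriangular.card_firstZero {F : Type*} [Field F] [Fintype F] {n : ℕ}
    {f : MvPolynomial (Fin n) F} {a : Fin n → F} {b : F} (hf : IsFullyTriangular f a b)
    {k : ℕ} (hk : k < n) :
    Nat.card {x : Fin n → F // (∀ i : Fin n, (i : ℕ) < k → x i ≠ 0) ∧ x ⟨k, hk⟩ = 0 ∧
        eval x f = 0} =
      Fintype.card F ^ (n - k - 1) * torusRootCount (truncate k f) := by
  have h := Nat.card_congr (firstZeroEquiv hk fun y : Fin k → F => eval y (truncate k f) = 0)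
  rw [Nat.card_prod, Nat.card_fun, Nat.card_fin, Nat.card_eq_fintype_card (α := F)] at h
  rw [torusRootCount, ← h]
  refine Nat.card_congr (Equiv.subtypeEquivRight fun x => ?_)
  refine and_congr_right fun _ => and_congr_right fun h0 => ?_
  rw [eval_truncate, hf.eval_eq_of_apply_eq_zero h0 (y := fun i : Fin n =>
    if h : (i : ℕ) < k then x (Fin.castLE hk.le ⟨i, h⟩) else 0) (by simp)]
  intro i hi
  have hi' : (i : ℕ) < k := hi
  simp [hi']

theorem torusRootCount_truncate_self {F : Type*} [Field F] {n : ℕ} (f : MvPolynomial (Fin n) F) :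
    torusRootCount (truncate n f) =
      Nat.card {x : Fin n → F // (∀ i : Fin n, (i : ℕ) < n → x i ≠ 0) ∧ eval x f = 0} := by
  unfold torusRootCount
  simp only [eval_truncate]
  refine Nat.card_congr
    { toFun := fun y => ⟨fun i => y.1 i, fun i _ => (y.1 i).ne_zero, by simpa using y.2⟩
      invFun := fun x => ⟨fun i => Units.mk0 (x.1 i) (x.2.1 i i.2), by simpa using x.2.2⟩
      left_inv := fun y => by ext; simp
      right_inv := fun x => by ext; simp }

/-- The roots of a fully triangular polynomial, sorted by the position of their first vanishing
coordinate. -/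
theorem IsFullyTriangular.rootCount_eq {F : Type*} [Field F] [Fintype F] {n : ℕ}
    {f : MvPolynomial (Fin n) F} {a : Fin n → F} {b : F} (hf : IsFullyTriangular f a b) :
    rootCount f = ∑ k ∈ Finset.range n,
        Fintype.card F ^ (n - k - 1) * torusRootCount (truncate k f) +
      torusRootCount (truncate n f) := by
  classical
  -- Induction peels off one coordinate at a time: points with the first m coordinates nonzero split
  -- by whether the next one is zero.
  have key : ∀ m ≤ n, rootCount f = ∑ k ∈ Finset.range m,
        Fintype.card F ^ (n - k - 1) * torusRootCount (truncate k f) +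
      Nat.card {x : Fin n → F // (∀ i : Fin n, (i : ℕ) < m → x i ≠ 0) ∧ eval x f = 0} := by
    intro m
    induction m with
    | zero => intro _; simp [rootCount]
    | succ m ih =>
      intro hm
      rw [ih (by omega), Finset.sum_range_succ, add_assoc, ← hf.card_firstZero hm]
      congr 1
      simp only [Nat.card_eq_fintype_card, Fintype.card_subtype]
      rw [← Finset.card_union_of_disjoint]
      · congr 1
        ext x
        simp only [Finset.mem_filter, Finset.mem_univ, true_and, Finset.mem_union]
        constructor
        · rintro ⟨h1, h2⟩
          by_cases h0 : x ⟨m, hm⟩ = 0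
          · exact Or.inl ⟨h1, h0, h2⟩
          · refine Or.inr ⟨fun i hi => ?_, h2⟩
            rcases Nat.lt_succ_iff_lt_or_eq.1 hi with h | h
            · exact h1 i h
            · rwa [show i = ⟨m, hm⟩ from Fin.ext h]
        · rintro (⟨h1, _, h2⟩ | ⟨h1, h2⟩)
          · exact ⟨h1, h2⟩
          · exact ⟨fun i hi => h1 i (by omega), h2⟩
      · rw [Finset.disjoint_filter]
        rintro x _ ⟨_, h0, _⟩ ⟨h1, _⟩
        exact h1 ⟨m, hm⟩ (Nat.lt_succ_self m) h0
  rw [key n le_rfl, torusRootCount_truncate_self]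

/-! ### Reduction to the diagonal polynomial -/

theorem torusRootCount_truncate_quadDiagonal {F : Type*} [Field F] [Fintype F] [DecidableEq F]
    {n k : ℕ} (hk : k ≤ n) (a : Fin n → F) (b : F) :
    torusRootCount (truncate k (quadDiagonal a b)) = (Finset.univ.filter fun x : Fin k → Fˣ =>
      ∑ j, a (Fin.castLE hk j) * (x j : F) ^ 2 = b).card := by
  rw [torusRootCount, Nat.card_eq_fintype_card, Fintype.card_subtype]
  congr 1
  refine Finset.filter_congr fun x _ => ?_
  rw [eval_truncate, quadDiagonal]
  simp only [map_sub, map_sum, map_mul, map_pow, eval_C, eval_X]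
  rw [sub_eq_zero]
  obtain ⟨l, rfl⟩ := Nat.exists_eq_add_of_le hk
  rw [Fin.sum_univ_add]
  simp
  rfl

theorem card_filter_comp_castLE {n k : ℕ} (hk : k ≤ n) (p : Fin n → Prop) [DecidablePred p] :
    (Finset.univ.filter fun j : Fin k => (j : ℕ) < k ∧ p (Fin.castLE hk j)).card =
      (Finset.univ.filter fun j : Fin n => (j : ℕ) < k ∧ p j).card := by
  rw [← Finset.card_map (Fin.castLEEmb hk)]
  congr 1
  ext j
  simp only [Finset.mem_map, Finset.mem_filter, Finset.mem_univ, true_and, Fin.castLEEmb_apply]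
  constructor
  · rintro ⟨i, ⟨hi, hp⟩, rfl⟩
    exact ⟨hi, hp⟩
  · rintro ⟨hj, hp⟩
    exact ⟨⟨j, hj⟩, ⟨hj, hp⟩, rfl⟩

/-- All truncations of a fully triangular polynomial that is totally `*`-equivalent to a
quadratic diagonal one, including the constant one, have the same number of roots with nonzero
coordinates as those of the diagonal polynomial. -/
theorem torusRootCount_truncate_eq {F : Type*} [Field F] [Fintype F] [DecidableEq F] {n : ℕ}
    {f : MvPolynomial (Fin n) F} {a : Fin n → F} {b : F}
    (hf : IsFullyTriangular f a b) (hfg : TotallyStarEquiv f (quadDiagonal a b)) {k : ℕ}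
    (hk : k ≤ n) :
    torusRootCount (truncate k f) = torusRootCount (truncate k (quadDiagonal a b)) := by
  -- Total `*`-equivalence says nothing at k = 0, but there both truncations are the constant -b.
  rcases Nat.eq_zero_or_pos k with rfl | hpos
  · unfold torusRootCount
    refine Nat.card_congr (Equiv.subtypeEquivRight fun x => ?_)
    obtain ⟨-, d, hd, rfl⟩ := hf
    rw [eval_truncate, eval_truncate, quadDiagonal]
    have h0 (j : Fin n) : ∏ i ∈ Finset.Iic j, (0 : F) ^ d i j = 0 :=
      Finset.prod_eq_zero (Finset.mem_Iic.2 le_rfl) (zero_pow (hd j j le_rfl).ne')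
    simp [h0]
  · exact (hfg k hpos hk).torusRootCount_eq

/-! ### Summation and the final formulas -/

theorem sum_pow_mul_add_eq {q : ℂ} (hq : q ≠ 0) {n : ℕ} (hn : 1 ≤ n) (E : ℕ → ℂ) :
    ∑ k ∈ Finset.range n, q ^ (n - k - 1) * ((q - 1) ^ k / q + E k) + ((q - 1) ^ n / q + E n) =
      q ^ ((n : ℤ) - 1) + q ^ ((n : ℤ) - 1) * E 0 + E n +
        ∑ k ∈ Finset.Icc 1 (n - 1), q ^ ((n : ℤ) - (k : ℤ) - 1) * E k := by
  obtain ⟨m, rfl⟩ := Nat.exists_eq_add_of_le' hn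
  -- A geometric sum without denominator, because q - (q - 1) = 1; the last main term cancels its (q
  -- - 1)^(m+1).
  have hgeom : ∑ k ∈ Finset.range (m + 1), q ^ (m + 1 - k - 1) * (q - 1) ^ k =
      q ^ (m + 1) - (q - 1) ^ (m + 1) := by
    have h := geom_sum₂_mul (q - 1) q (m + 1)
    rw [sub_sub_cancel_left, mul_neg_one, neg_eq_iff_eq_neg, neg_sub] at h
    rw [← h]
    refine Finset.sum_congr rfl fun k _ => ?_
    rw [mul_comm, Nat.sub_right_comm]
  have hE : ∑ k ∈ Finset.range (m + 1), q ^ (m + 1 - k - 1) * E k = q ^ m * E 0 +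
      ∑ k ∈ Finset.Icc 1 m, q ^ (((m + 1 : ℕ) : ℤ) - (k : ℤ) - 1) * E k := by
    rw [Finset.range_eq_Ico, Finset.sum_eq_sum_Ico_succ_bot (Nat.succ_pos m)]
    congr 1
    refine Finset.sum_congr rfl fun k hk => ?_
    have hk' := Finset.mem_Ico.1 hk
    rw [← zpow_natCast]
    congr 2
    omega
  simp only [mul_add, Finset.sum_add_distrib]
  rw [hE]
  simp only [← mul_div_assoc]
  rw [← Finset.sum_div, hgeom, show ((m + 1 : ℕ) : ℤ) - 1 = (m : ℕ) by push_cast; ring,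
    zpow_natCast, pow_succ q m, Nat.add_sub_cancel]
  field_simp
  ring

end

theorem theorem4p3 {F : Type*} [Field F] [Fintype F] [DecidableEq F]
    (q : ℕ) (hq : Fintype.card F = q) (hodd : Odd q)
    (n : ℕ) (hn : 1 ≤ n) (a : Fin n → F) (b : F) (f : MvPolynomial (Fin n) F)
    (hf : IsFullyTriangular f a b)
    (hfg : TotallyStarEquiv f (quadDiagonal a b))
    (w ζ₁ ζ₂ : ℂ) (hw : w ^ 2 = (q : ℂ) * (-1) ^ ((q - 1) / 2))
    (hζ₁ : ζ₁ = w - 1) (hζ₂ : ζ₂ = -w - 1)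
    (r s : ℕ → ℕ) (hr : r = numSq a) (hs : s = numNonsq a) :
    (b ≠ 0 →
      (rootCount f : ℂ) =
        (q : ℂ) ^ ((n : ℤ) - 2) * ((q : ℂ) - 1)
        - 1 / (2 * (q : ℂ)) * (ζ₁ ^ r n * ζ₂ ^ s n + ζ₂ ^ r n * ζ₁ ^ s n)
        + ((quadraticChar F b : ℤ) : ℂ) / (2 * w)
            * (ζ₁ ^ r n * ζ₂ ^ s n - ζ₂ ^ r n * ζ₁ ^ s n)
        + ∑ k ∈ Finset.Icc 1 (n - 1), (q : ℂ) ^ ((n : ℤ) - (k : ℤ) - 1) *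
            (- (1 / (2 * (q : ℂ))) * (ζ₁ ^ r k * ζ₂ ^ s k + ζ₂ ^ r k * ζ₁ ^ s k)
              + ((quadraticChar F b : ℤ) : ℂ) / (2 * w)
                  * (ζ₁ ^ r k * ζ₂ ^ s k - ζ₂ ^ r k * ζ₁ ^ s k))) ∧
    (b = 0 →
      (rootCount f : ℂ) =
        (q : ℂ) ^ ((n : ℤ) - 1) + (q : ℂ) ^ ((n : ℤ) - 2) * ((q : ℂ) - 1)
        + ((q : ℂ) - 1) / (2 * (q : ℂ)) * (ζ₁ ^ r n * ζ₂ ^ s n + ζ₂ ^ r n * ζ₁ ^ s n)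
        + ((q : ℂ) - 1) / 2 * ∑ k ∈ Finset.Icc 1 (n - 1), (q : ℂ) ^ ((n : ℤ) - (k : ℤ) - 2) *
            (ζ₁ ^ r k * ζ₂ ^ s k + ζ₂ ^ r k * ζ₁ ^ s k)) := by
  subst hq
  have hq0 : (Fintype.card F : ℂ) ≠ 0 := Nat.cast_ne_zero.2 Fintype.card_ne_zero
  set E : ℕ → ℂ := fun k =>
    if b = 0 then ((Fintype.card F : ℂ) - 1) / (2 * Fintype.card F) *
        (ζ₁ ^ r k * ζ₂ ^ s k + ζ₂ ^ r k * ζ₁ ^ s k)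
      else -(1 / (2 * (Fintype.card F : ℂ))) * (ζ₁ ^ r k * ζ₂ ^ s k + ζ₂ ^ r k * ζ₁ ^ s k)
        + ((quadraticChar F b : ℤ) : ℂ) / (2 * w) *
          (ζ₁ ^ r k * ζ₂ ^ s k - ζ₂ ^ r k * ζ₁ ^ s k) with hE
  have htorus (k : ℕ) (hk : k ≤ n) : (torusRootCount (truncate k f) : ℂ) =
      ((Fintype.card F : ℂ) - 1) ^ k / Fintype.card F + E k := by
    have hrk : r k = numSq (fun j => a (Fin.castLE hk j)) k := by
      rw [hr]
      exact (card_filter_comp_castLE hk fun j => quadraticChar F (a j) = 1).symm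
    have hsk : s k = numNonsq (fun j => a (Fin.castLE hk j)) k := by
      rw [hs]
      exact (card_filter_comp_castLE hk fun j => quadraticChar F (a j) = -1).symm
    rw [torusRootCount_truncate_eq hf hfg hk, torusRootCount_truncate_quadDiagonal hk,
      card_diagonal_torus_eq hodd (fun j => hf.1 _) b hw rfl rfl]
    simp only [hE, hζ₁, hζ₂, hrk, hsk]
  -- Hence E 0 is -1/q for b ≠ 0 and (q - 1)/q for b = 0. This yields the term q^(n-2) (q - 1) in
  -- both formulas, combined with q^(n-1) in the first case.
  have hr0 : r 0 = 0 := by simp [hr, numSq]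
  have hs0 : s 0 = 0 := by simp [hs, numNonsq]
  have hcount : (rootCount f : ℂ) = ∑ k ∈ Finset.range n, (Fintype.card F : ℂ) ^ (n - k - 1) *
        (((Fintype.card F : ℂ) - 1) ^ k / Fintype.card F + E k) +
      (((Fintype.card F : ℂ) - 1) ^ n / Fintype.card F + E n) := by
    rw [hf.rootCount_eq]
    push_cast
    rw [htorus n le_rfl]
    congr 1
    exact Finset.sum_congr rfl fun k hk => by rw [htorus k (Finset.mem_range.1 hk).le]
  have hpow : (Fintype.card F : ℂ) ^ ((n : ℤ) - 1) =
      (Fintype.card F : ℂ) ^ ((n : ℤ) - 2) * Fintype.card F := by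
    rw [← zpow_add_one₀ hq0]
    congr 1
    ring
  rw [hcount, sum_pow_mul_add_eq hq0 hn E]
  constructor
  · intro hb
    simp only [hE, if_neg hb, hr0, hs0]
    rw [hpow]
    field_simp
    ring
  · intro hb
    simp only [hE, if_pos hb, hr0, hs0]
    rw [Finset.mul_sum, hpow]
    congr 1
    · field_simp
      ring
    · refine Finset.sum_congr rfl fun k _ => ?_
      rw [show (n : ℤ) - k - 1 = (n - k - 2) + 1 by ring, zpow_add_one₀ hq0]
      field_simp
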